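/- Let $k$ be a field and let $\Lambda$ and $\Gamma$ be finite-dimensional $k$-algebras which are Gorenstein, i.e. each has finite injective dimension both as a left and as a right module over itself. Bimodules are understood over $k$ ($k$ acts centrally), and an $A$-$A$-bimodule is called finitely generated, respectively of finite projective dimension, if it is so as a module over $A\otimes_k A^{\mathrm{op}}$. Let $X$ be a $\Gamma$-$\Lambda$-bimodule and $Y$ a $\Lambda$-$\Gamma$-bimodule which induce a singular equivalence of Morita type between $\Lambda$ and $\Gamma$, i.e. 1. $X$ is finitely generated and projective as a left $\Gamma$-module and as a right $\Lambda$-module; 2. $Y$ is finitely generated and projective as a left $\Lambda$-module and as a right $\Gamma$-module; 3. there is a finitely generated $\Gamma$-$\Gamma$-bimodule $Q$ of finite projective dimension with $X\otimes_\Lambda Y\cong\Gamma\oplus Q$ as $\Gamma$-$\Gamma$-bimodules; 4. there is a finitely generated $\Lambda$-$\Lambda$-bimodule $P$ of finite projective dimension with $Y\otimes_\Gamma X\cong\Lambda\oplus P$ as $\Lambda$-$\Lambda$-bimodules. A left module $M$ over a ring $A$ is called Gorenstein-projective if there is an acyclic complex $P^\bullet=(\cdots\to P^{-1}\to P^0\xrightarrow{f^0}P^1\to\cdots)$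 of (not necessarily finitely generated) projective left $A$-modules such that $\mathrm{Hom}_A(P^\bullet,A)$ is also acyclic and $M\cong\mathrm{coker}\,f^0$. Let $V$ be a finitely generated Gorenstein-projective left $\Lambda$-module. Then $X\otimes_\Lambda V$ is a finitely generated Gorenstein-projective left $\Gamma$-module. Moreover, if $P$ is any finitely generated $\Lambda$-$\Lambda$-bimodule of finite projective dimension with $Y\otimes_\Gamma X\cong\Lambda\oplus P$ as $\Lambda$-$\Lambda$-bimodules, then $P\otimes_\Lambda V$ is a finitely generated projective left $\Lambda$-module. -/

import Mathlib

open scoped TensorProduct MulOpposite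

universe w u v₁ v₂ v₃ v₄ v₅

/-! Right `A`-modules are modules over `Aᵐᵒᵖ`. An `A`-`B`-bimodule over `k` is a `k`-vector space
with a left action of `A` and a right action of `B`, both extending the action of `k`, which
commute with each other. -/

section BalancedTensor

variable (A : Type v₁) [Ring A]
  (M : Type v₂) [AddCommGroup M] [Module Aᵐᵒᵖ M]
  (N : Type v₃) [AddCommGroup N] [Module A N]

/-- The subgroup of `M ⊗_ℤ N` generated by the elements `m a ⊗ n - m ⊗ a n`. -/
def balancedRelations : AddSubgroup (M ⊗[ℤ] N) :=
  AddSubgroup.closure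
    {t | ∃ (m : M) (a : A) (n : N), t = (MulOpposite.op a • m) ⊗ₜ[ℤ] n - m ⊗ₜ[ℤ] (a • n)}

/-- The tensor product `M ⊗_A N` of a right `A`-module `M` and a left `A`-module `N` over a
(possibly noncommutative) ring `A`. -/
def BalancedTensor : Type (max v₂ v₃) := (M ⊗[ℤ] N) ⧸ balancedRelations A M N

namespace BalancedTensor

instance : AddCommGroup (BalancedTensor A M N) :=
  inferInstanceAs (AddCommGroup ((M ⊗[ℤ] N) ⧸ balancedRelations A M N))

variable {M N}

/-- The pure tensor `m ⊗ n` in `M ⊗_A N`. -/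
def tmul (m : M) (n : N) : BalancedTensor A M N :=
  QuotientAddGroup.mk' (balancedRelations A M N) (m ⊗ₜ[ℤ] n)

variable {A}

theorem add_tmul (m m' : M) (n : N) : tmul A (m + m') n = tmul A m n + tmul A m' n := by
  unfold tmul
  rw [TensorProduct.add_tmul, map_add]
  rfl

theorem tmul_add (m : M) (n n' : N) : tmul A m (n + n') = tmul A m n + tmul A m n' := by
  unfold tmul
  rw [TensorProduct.tmul_add, map_add]
  rfl

theorem op_smul_tmul (m : M) (a : A) (n : N) :
    tmul A (MulOpposite.op a • m) n = tmul A m (a • n) := by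
  refine (QuotientAddGroup.eq_iff_sub_mem (N := balancedRelations A M N)).2 ?_
  exact AddSubgroup.subset_closure ⟨m, a, n, rfl⟩

@[elab_as_elim]
theorem induction_on {p : BalancedTensor A M N → Prop} (t : BalancedTensor A M N)
    (h0 : p 0) (h1 : ∀ m n, p (tmul A m n)) (h2 : ∀ s t, p s → p t → p (s + t)) : p t := by
  obtain ⟨t, rfl⟩ := QuotientAddGroup.mk'_surjective (balancedRelations A M N) t
  induction t using TensorProduct.induction_on with
  | zero => exact h0
  | tmul m n => exact h1 m n
  | add s t hs ht => rw [map_add]; exact h2 _ _ hs ht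

/-- The endomorphism `f ⊗ g` of `M ⊗_A N` for endomorphisms `f`, `g` of the abelian groups `M`, `N`
which commute with the actions of `A`. -/
def mapEnd (f : M →+ M) (g : N →+ N)
    (hf : ∀ (a : A) (m : M), f (MulOpposite.op a • m) = MulOpposite.op a • f m)
    (hg : ∀ (a : A) (n : N), g (a • n) = a • g n) :
    BalancedTensor A M N →+ BalancedTensor A M N :=
  QuotientAddGroup.map (balancedRelations A M N) (balancedRelations A M N)
    (TensorProduct.map f.toIntLinearMap g.toIntLinearMap).toAddMonoidHom (by
      refine (AddSubgroup.closure_le _).2 ?_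
      rintro _ ⟨m, a, n, rfl⟩
      refine AddSubgroup.subset_closure ⟨f m, a, g n, ?_⟩
      simp [hf, hg])

theorem mapEnd_tmul (f : M →+ M) (g : N →+ N)
    (hf : ∀ (a : A) (m : M), f (MulOpposite.op a • m) = MulOpposite.op a • f m)
    (hg : ∀ (a : A) (n : N), g (a • n) = a • g n) (m : M) (n : N) :
    mapEnd f g hf hg (tmul A m n) = tmul A (f m) (g n) := rfl

section Left

variable {B : Type v₄} [Ring B] [Module B M] [SMulCommClass B Aᵐᵒᵖ M]

/-- Left multiplication by `c` on `M ⊗_A N`. -/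
def leftSMul (c : B) : BalancedTensor A M N →+ BalancedTensor A M N :=
  mapEnd (DistribSMul.toAddMonoidHom M c) (AddMonoidHom.id N)
    (fun a m => smul_comm c (MulOpposite.op a) m) (fun _ _ => rfl)

theorem leftSMul_tmul (c : B) (m : M) (n : N) :
    leftSMul c (tmul A m n) = tmul A (c • m) n := rfl

/-- If `M` is a `B`-`A`-bimodule, then `M ⊗_A N` is a left `B`-module by `b (m ⊗ n) = b m ⊗ n`. -/
instance leftModule : Module B (BalancedTensor A M N) where
  smul c t := leftSMul c t
  one_smul t := by
    change leftSMul 1 t = t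
    induction t using induction_on with
    | h0 => exact map_zero _
    | h1 m n => rw [leftSMul_tmul, one_smul]
    | h2 s t hs ht => rw [map_add, hs, ht]
  mul_smul b c t := by
    change leftSMul (b * c) t = leftSMul b (leftSMul c t)
    induction t using induction_on with
    | h0 => simp only [map_zero]
    | h1 m n => simp only [leftSMul_tmul, mul_smul]
    | h2 s t hs ht => simp only [map_add, hs, ht]
  smul_zero c := map_zero (leftSMul c)
  smul_add c := map_add (leftSMul c)
  add_smul b c t := by
    change leftSMul (b + c) t = leftSMul b t + leftSMul c t
    induction t using induction_on with
    | h0 => simp only [map_zero, add_zero]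
    | h1 m n => simp only [leftSMul_tmul, add_smul, add_tmul]
    | h2 s t hs ht => simp only [map_add, hs, ht]; abel
  zero_smul t := by
    change leftSMul 0 t = 0
    induction t using induction_on with
    | h0 => exact map_zero _
    | h1 m n =>
      have h := add_tmul (A := A) (0 : M) 0 n
      simp only [add_zero] at h
      rw [leftSMul_tmul, zero_smul]
      exact left_eq_add.1 h
    | h2 s t hs ht => rw [map_add, hs, ht, add_zero]

theorem smul_tmul_left (c : B) (m : M) (n : N) :
    c • tmul A m n = tmul A (c • m) n := rfl

end Left

section Right

variable {C : Type v₅} [Ring C] [Module Cᵐᵒᵖ N] [SMulCommClass A Cᵐᵒᵖ N]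

/-- Right multiplication by `c` on `M ⊗_A N`. -/
def rightSMul (c : Cᵐᵒᵖ) : BalancedTensor A M N →+ BalancedTensor A M N :=
  mapEnd (AddMonoidHom.id M) (DistribSMul.toAddMonoidHom N c)
    (fun _ _ => rfl) (fun a n => (smul_comm a c n).symm)

theorem rightSMul_tmul (c : Cᵐᵒᵖ) (m : M) (n : N) :
    rightSMul c (tmul A m n) = tmul A m (c • n) := rfl

/-- If `N` is an `A`-`C`-bimodule, then `M ⊗_A N` is a right `C`-module by
`(m ⊗ n) c = m ⊗ n c`. -/
instance rightModule : Module Cᵐᵒᵖ (BalancedTensor A M N) where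
  smul c t := rightSMul c t
  one_smul t := by
    change rightSMul 1 t = t
    induction t using induction_on with
    | h0 => exact map_zero _
    | h1 m n => rw [rightSMul_tmul, one_smul]
    | h2 s t hs ht => rw [map_add, hs, ht]
  mul_smul b c t := by
    change rightSMul (b * c) t = rightSMul b (rightSMul c t)
    induction t using induction_on with
    | h0 => simp only [map_zero]
    | h1 m n => simp only [rightSMul_tmul, mul_smul]
    | h2 s t hs ht => simp only [map_add, hs, ht]
  smul_zero c := map_zero (rightSMul c)
  smul_add c := map_add (rightSMul c)
  add_smul b c t := by
    change rightSMul (b + c) t = rightSMul b t + rightSMul c t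
    induction t using induction_on with
    | h0 => simp only [map_zero, add_zero]
    | h1 m n => simp only [rightSMul_tmul, add_smul, tmul_add]
    | h2 s t hs ht => simp only [map_add, hs, ht]; abel
  zero_smul t := by
    change rightSMul 0 t = 0
    induction t using induction_on with
    | h0 => exact map_zero _
    | h1 m n =>
      have h := tmul_add (A := A) m (0 : N) 0
      simp only [add_zero] at h
      rw [rightSMul_tmul, zero_smul]
      exact left_eq_add.1 h
    | h2 s t hs ht => rw [map_add, hs, ht, add_zero]

theorem smul_tmul_right (c : Cᵐᵒᵖ) (m : M) (n : N) :
    c • tmul A m n = tmul A m (c • n) := rfl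

end Right

end BalancedTensor

end BalancedTensor

/-- A ring `A` is Gorenstein if it has finite injective dimension as a left and as a right module
over itself. -/
def IsGorensteinAlgebra (A : Type u) [Ring A] : Prop :=
  (∃ n : ℕ, CategoryTheory.HasInjectiveDimensionLE (ModuleCat.of A A) n) ∧
  (∃ n : ℕ, CategoryTheory.HasInjectiveDimensionLE (ModuleCat.of Aᵐᵒᵖ A) n)

/-- A left `A`-module `M` is Gorenstein-projective if there is an acyclic complex
`⋯ → P₋₁ → P₀ → P₁ → ⋯` of (not necessarily finitely generated) projective left `A`-modules such
that the complex `Hom_A(P, A)` is acyclic as well and `M` is the cokernel of `P₀ → P₁`. -/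
def IsGorensteinProjective (A : Type u) [Ring A] (M : Type u) [AddCommGroup M] [Module A M] :
    Prop :=
  ∃ (P : ℤ → ModuleCat.{u} A) (d : ∀ i : ℤ, P i →ₗ[A] P (i + 1)),
    (∀ i, Module.Projective A (P i)) ∧
    (∀ i, Function.Exact (d i) (d (i + 1))) ∧
    (∀ i, Function.Exact
      (fun φ : P (i + 1 + 1) →ₗ[A] A => φ ∘ₗ d (i + 1))
      (fun φ : P (i + 1) →ₗ[A] A => φ ∘ₗ d i)) ∧
    Nonempty (M ≃ₗ[A] (P (0 + 1) ⧸ LinearMap.range (d 0)))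

section Bimodules

variable (k : Type w) [Field k] (A : Type u) [Ring A] [Algebra k A] (B : Type u) [Ring B]
  [Algebra k B]

/-- The `A`-`B`-bimodule `M`, as a left module over `A ⊗_k Bᵐᵒᵖ`, is finitely generated. -/
def IsFiniteBimodule (M : Type u) [AddCommGroup M] [Module k M] [Module A M] [Module Bᵐᵒᵖ M]
    [IsScalarTower k A M] [IsScalarTower k Bᵐᵒᵖ M] [SMulCommClass A Bᵐᵒᵖ M] : Prop :=
  letI : Module (A ⊗[k] Bᵐᵒᵖ) M := TensorProduct.Algebra.module
  Module.Finite (A ⊗[k] Bᵐᵒᵖ) M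

/-- The `A`-`B`-bimodule `M`, as a left module over `A ⊗_k Bᵐᵒᵖ`, has finite projective
dimension. -/
def HasFiniteBimoduleProjDim (M : Type u) [AddCommGroup M] [Module k M] [Module A M]
    [Module Bᵐᵒᵖ M] [IsScalarTower k A M] [IsScalarTower k Bᵐᵒᵖ M] [SMulCommClass A Bᵐᵒᵖ M] :
    Prop :=
  letI : Module (A ⊗[k] Bᵐᵒᵖ) M := TensorProduct.Algebra.module
  ∃ n : ℕ, CategoryTheory.HasProjectiveDimensionLE (ModuleCat.of (A ⊗[k] Bᵐᵒᵖ) M) n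

/-- `M` and `N` are isomorphic as `A`-`B`-bimodules. -/
def BimoduleIso (M : Type v₁) [AddCommGroup M] [Module A M] [Module Bᵐᵒᵖ M]
    (N : Type v₂) [AddCommGroup N] [Module A N] [Module Bᵐᵒᵖ N] : Prop :=
  ∃ e : M ≃ₗ[A] N, ∀ (b : Bᵐᵒᵖ) (m : M), e (b • m) = b • e m

/-- For an `A`-`B`-bimodule `M` and a `B`-`A`-bimodule `N`: the `A`-`A`-bimodule `P` is finitely
generated, has finite projective dimension, and satisfies `M ⊗_B N ≅ A ⊕ P` as
`A`-`A`-bimodules. -/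
structure IsFiniteProjDimComplement
    (M : Type u) [AddCommGroup M] [Module A M] [Module Bᵐᵒᵖ M] [SMulCommClass A Bᵐᵒᵖ M]
    (N : Type u) [AddCommGroup N] [Module B N] [Module Aᵐᵒᵖ N] [SMulCommClass B Aᵐᵒᵖ N]
    (P : Type u) [AddCommGroup P] [Module k P] [Module A P] [Module Aᵐᵒᵖ P]
    [IsScalarTower k A P] [IsScalarTower k Aᵐᵒᵖ P] [SMulCommClass A Aᵐᵒᵖ P] : Prop where
  finite : IsFiniteBimodule k A A P
  finiteProjDim : HasFiniteBimoduleProjDim k A A P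
  iso : BimoduleIso A A (BalancedTensor B M N) (A × P)

/-- The `G`-`L`-bimodule `X` and the `L`-`G`-bimodule `Y` induce a singular equivalence of Morita
type between the `k`-algebras `L` and `G`. -/
structure IsSingularEquivalenceOfMoritaType
    (L : Type u) [Ring L] [Algebra k L] (G : Type u) [Ring G] [Algebra k G]
    (X : Type u) [AddCommGroup X] [Module G X] [Module Lᵐᵒᵖ X] [SMulCommClass G Lᵐᵒᵖ X]
    (Y : Type u) [AddCommGroup Y] [Module L Y] [Module Gᵐᵒᵖ Y] [SMulCommClass L Gᵐᵒᵖ Y] :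
    Prop where
  finite_left_X : Module.Finite G X
  projective_left_X : Module.Projective G X
  finite_right_X : Module.Finite Lᵐᵒᵖ X
  projective_right_X : Module.Projective Lᵐᵒᵖ X
  finite_left_Y : Module.Finite L Y
  projective_left_Y : Module.Projective L Y
  finite_right_Y : Module.Finite Gᵐᵒᵖ Y
  projective_right_Y : Module.Projective Gᵐᵒᵖ Y
  exists_complement_G : ∃ (Q : Type u) (_ : AddCommGroup Q) (_ : Module k Q) (_ : Module G Q)
    (_ : Module Gᵐᵒᵖ Q) (_ : IsScalarTower k G Q) (_ : IsScalarTower k Gᵐᵒᵖ Q)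
    (_ : SMulCommClass G Gᵐᵒᵖ Q), IsFiniteProjDimComplement k G L X Y Q
  exists_complement_L : ∃ (P : Type u) (_ : AddCommGroup P) (_ : Module k P) (_ : Module L P)
    (_ : Module Lᵐᵒᵖ P) (_ : IsScalarTower k L P) (_ : IsScalarTower k Lᵐᵒᵖ P)
    (_ : SMulCommClass L Lᵐᵒᵖ P), IsFiniteProjDimComplement k L G Y X P

end Bimodules

/-! Take an acyclic complex `T` of projectives in which `V` is a cokernel. If a bimodule `M` is
projective on both sides, then `M ⊗ T` is again an acyclic complex of projectives, and its cokernels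
are the `M ⊗ coker` (`exact_map_id`, `projective_left`, `cokerEquiv`). The proof uses this for `M =
X` and for `M = P`.

For `X`, the remaining point is that `Hom(X ⊗ T, G)` is acyclic. Since `G` has finite injective
dimension as a left module, dimension shifting gives this for every acyclic complex of projectives
(`exists_extension_of_hasInjectiveDimensionLE`).

The bimodule `P` is a summand of `Y ⊗ X`, hence projective on each side. Because it is projective on
the right, a projective resolution over `L ⊗ Lᵐᵒᵖ` splits as right modules and stays exact under `-
⊗ W`. Its terms become projective, since `(L ⊗_k Lᵐᵒᵖ) ⊗_L W ≅ L ⊗_k W` is free over `L`. So one `n`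
bounds the projective dimension of `P ⊗ W` for all `W` (`hasProjectiveDimensionLE_of_enveloping`).
Every cokernel of `P ⊗ T` is an `n`-th syzygy of a later one, so all of them are projective
(`projective_coker_of_exact`), and `P ⊗ V` is among them. -/

namespace BalancedTensor

/-! ### Maps out of and between tensor products over a noncommutative ring. -/

section Functoriality

variable {A : Type*} [Ring A]
  {M : Type*} [AddCommGroup M] [Module Aᵐᵒᵖ M] {M' : Type*} [AddCommGroup M'] [Module Aᵐᵒᵖ M']
  {N : Type*} [AddCommGroup N] [Module A N] {N' : Type*} [AddCommGroup N'] [Module A N']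
  {N'' : Type*} [AddCommGroup N''] [Module A N'']

/-- The additive map out of `M ⊗_A N` induced by a balanced biadditive map. -/
def lift {Q : Type*} [AddCommGroup Q] (f : M →+ N →+ Q)
    (hf : ∀ (a : A) (m : M) (n : N), f (MulOpposite.op a • m) n = f m (a • n)) :
    BalancedTensor A M N →+ Q :=
  QuotientAddGroup.lift (balancedRelations A M N)
    (TensorProduct.liftAddHom f (fun r m n => by simp)) (by
      refine (AddSubgroup.closure_le _).2 ?_
      rintro _ ⟨m, a, n, rfl⟩
      change TensorProduct.liftAddHom f _ _ = 0
      rw [map_sub, TensorProduct.liftAddHom_tmul, TensorProduct.liftAddHom_tmul, hf, sub_self])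

/-- The pure tensor as a biadditive map. -/
def mkAddHom (A : Type*) [Ring A] (M : Type*) [AddCommGroup M] [Module Aᵐᵒᵖ M]
    (N : Type*) [AddCommGroup N] [Module A N] : M →+ N →+ BalancedTensor A M N :=
  AddMonoidHom.mk' (fun m => AddMonoidHom.mk' (fun n => tmul A m n) (tmul_add m))
    (fun m m' => AddMonoidHom.ext fun n => add_tmul m m' n)

theorem mkAddHom_apply (m : M) (n : N) : mkAddHom A M N m n = tmul A m n := rfl

theorem zero_tmul (n : N) : tmul A (0 : M) n = 0 :=
  congrArg (fun f => f n) (map_zero (mkAddHom A M N))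

theorem tmul_zero (m : M) : tmul A m (0 : N) = 0 := map_zero (mkAddHom A M N m)

theorem addHom_ext {Q : Type*} [AddCommGroup Q] {f g : BalancedTensor A M N →+ Q}
    (h : ∀ m n, f (tmul A m n) = g (tmul A m n)) : f = g := by
  ext t
  induction t using induction_on with
  | h0 => rw [map_zero, map_zero]
  | h1 m n => exact h m n
  | h2 s t hs ht => rw [map_add, map_add, hs, ht]

/-- The tensor product of a map of right modules and a map of left modules. -/
def map (f : M →ₗ[Aᵐᵒᵖ] M') (g : N →ₗ[A] N') :
    BalancedTensor A M N →+ BalancedTensor A M' N' :=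
  lift (((mkAddHom A M' N').comp f.toAddMonoidHom).compl₂ g.toAddMonoidHom) (fun a m n => by
      change tmul A (f (MulOpposite.op a • m)) (g n) = tmul A (f m) (g (a • n))
      rw [map_smul, map_smul, op_smul_tmul])

theorem map_tmul (f : M →ₗ[Aᵐᵒᵖ] M') (g : N →ₗ[A] N') (m : M) (n : N) :
    map f g (tmul A m n) = tmul A (f m) (g n) := rfl

theorem map_surjective {f : M →ₗ[Aᵐᵒᵖ] M'} {g : N →ₗ[A] N'}
    (hf : Function.Surjective f) (hg : Function.Surjective g) :
    Function.Surjective (map f g) := by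
  intro t
  induction t using induction_on with
  | h0 => exact ⟨0, map_zero _⟩
  | h1 m n =>
    obtain ⟨m, rfl⟩ := hf m
    obtain ⟨n, rfl⟩ := hg n
    exact ⟨tmul A m n, rfl⟩
  | h2 s t hs ht =>
    obtain ⟨s, rfl⟩ := hs
    obtain ⟨t, rfl⟩ := ht
    exact ⟨s + t, map_add _ _ _⟩

/-- An additive map on `M ⊗_A N` commuting with the left action on pure tensors is linear. -/
def linearOfTmul {B : Type*} [Ring B] [Module B M] [SMulCommClass B Aᵐᵒᵖ M]
    {Q : Type*} [AddCommGroup Q] [Module B Q] (f : BalancedTensor A M N →+ Q)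
    (h : ∀ (b : B) m n, f (tmul A (b • m) n) = b • f (tmul A m n)) :
    BalancedTensor A M N →ₗ[B] Q :=
  { f with
    map_smul' := fun b t => by
      change f (b • t) = b • f t
      induction t using induction_on with
      | h0 => simp
      | h1 m n => exact h b m n
      | h2 s t hs ht => rw [smul_add, map_add, map_add, smul_add, hs, ht] }

/-- An additive map on `M ⊗_A N` commuting with the right action on pure tensors is linear. -/
def linearOfTmulRight {C : Type*} [Ring C] [Module Cᵐᵒᵖ N] [SMulCommClass A Cᵐᵒᵖ N]
    {Q : Type*} [AddCommGroup Q] [Module Cᵐᵒᵖ Q] (f : BalancedTensor A M N →+ Q)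
    (h : ∀ (c : Cᵐᵒᵖ) m n, f (tmul A m (c • n)) = c • f (tmul A m n)) :
    BalancedTensor A M N →ₗ[Cᵐᵒᵖ] Q :=
  { f with
    map_smul' := fun c t => by
      change f (c • t) = c • f t
      induction t using induction_on with
      | h0 => simp
      | h1 m n => exact h c m n
      | h2 s t hs ht => rw [smul_add, map_add, map_add, smul_add, hs, ht] }

/-- The map `M ⊗_A g` as a map of left `B`-modules. -/
def lTensor (B : Type*) [Ring B] (M : Type*) [AddCommGroup M] [Module Aᵐᵒᵖ M] [Module B M]
    [SMulCommClass B Aᵐᵒᵖ M] (g : N →ₗ[A] N') :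
    BalancedTensor A M N →ₗ[B] BalancedTensor A M N' :=
  linearOfTmul (map LinearMap.id g) (fun _ _ _ => rfl)

/-- The map `f ⊗_A N` as a map of left `B`-modules, for a map `f` of bimodules. -/
def rTensor {B : Type*} [Ring B] [Module B M] [SMulCommClass B Aᵐᵒᵖ M] [Module B M']
    [SMulCommClass B Aᵐᵒᵖ M'] (N : Type*) [AddCommGroup N] [Module A N] (f : M →ₗ[Aᵐᵒᵖ] M')
    (hf : ∀ (b : B) (m : M), f (b • m) = b • f m) :
    BalancedTensor A M N →ₗ[B] BalancedTensor A M' N :=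
  linearOfTmul (map f LinearMap.id) (fun b m n => by
    rw [map_tmul, map_tmul, hf, smul_tmul_left])

end Functoriality

/-! ### Tensor products with a projective factor as retracts of direct sums; finite generation. -/

section Projective

variable {A : Type*} [Ring A]
  {M : Type*} [AddCommGroup M] [Module Aᵐᵒᵖ M]
  {N : Type*} [AddCommGroup N] [Module A N] {N' : Type*} [AddCommGroup N'] [Module A N']
  {N'' : Type*} [AddCommGroup N''] [Module A N'']

/-- For `s : M → A^(M)` a map of right modules, the map `M ⊗_A N → N^(M)` induced by `s`. -/
noncomputable def toFinsuppOfRight (s : M →ₗ[Aᵐᵒᵖ] (M →₀ Aᵐᵒᵖ)) (N : Type*) [AddCommGroup N]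
    [Module A N] : BalancedTensor A M N →+ (M →₀ N) :=
  lift (AddMonoidHom.mk' (fun m => AddMonoidHom.mk'
      (fun n => (s m).mapRange (fun c => c.unop • n) (by simp))
      (fun n n' => by ext; simp)) (fun m m' => by ext; simp [add_smul]))
    (fun a m n => by ext; simp [mul_smul])

theorem toFinsuppOfRight_tmul (s : M →ₗ[Aᵐᵒᵖ] (M →₀ Aᵐᵒᵖ)) (m : M) (n : N) :
    toFinsuppOfRight s N (tmul A m n) =
      (s m).mapRange (fun c => c.unop • n) (by simp) := rfl

/-- Naturality in `N`: with the same property of `ofFinsuppRight`, it lets exactness be tested on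
coordinates. -/
theorem toFinsuppOfRight_map (s : M →ₗ[Aᵐᵒᵖ] (M →₀ Aᵐᵒᵖ)) (g : N →ₗ[A] N')
    (t : BalancedTensor A M N) :
    toFinsuppOfRight s N' (map LinearMap.id g t) =
      (toFinsuppOfRight s N t).mapRange g (map_zero g) := by
  induction t using induction_on with
  | h0 => simp
  | h1 m n => rw [map_tmul, toFinsuppOfRight_tmul, toFinsuppOfRight_tmul]; ext; simp
  | h2 s t hs ht =>
    rw [map_add, map_add, map_add, hs, ht, Finsupp.mapRange_add (map_add g)]

/-- The map `N^(M) → M ⊗_A N` sending `n` at position `m` to `m ⊗ n`. -/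
noncomputable def ofFinsuppRight (A : Type*) [Ring A] (M : Type*) [AddCommGroup M] [Module Aᵐᵒᵖ M]
    (N : Type*) [AddCommGroup N] [Module A N] : (M →₀ N) →+ BalancedTensor A M N :=
  Finsupp.liftAddHom (mkAddHom A M N)

theorem ofFinsuppRight_single (m : M) (n : N) :
    ofFinsuppRight A M N (Finsupp.single m n) = tmul A m n := by
  exact (Finsupp.liftAddHom_apply_single (mkAddHom A M N) m n).trans (mkAddHom_apply m n)

theorem ofFinsuppRight_mapRange (g : N →ₗ[A] N') (t : M →₀ N) :
    ofFinsuppRight A M N' (t.mapRange g (map_zero g)) =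
      map LinearMap.id g (ofFinsuppRight A M N t) := by
  induction t using Finsupp.induction_linear with
  | zero => simp
  | add s t hs ht => rw [Finsupp.mapRange_add (map_add g), map_add, map_add, map_add, hs, ht]
  | single m n => rw [Finsupp.mapRange_single, ofFinsuppRight_single, ofFinsuppRight_single]; rfl

theorem ofFinsuppRight_mapRange_smul (t : M →₀ Aᵐᵒᵖ) (n : N) :
    ofFinsuppRight A M N (t.mapRange (fun c => c.unop • n) (by simp)) =
      tmul A (Finsupp.linearCombination Aᵐᵒᵖ id t) n := by
  induction t using Finsupp.induction_linear with
  | zero => simp [zero_tmul]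
  | add s t hs ht =>
    rw [Finsupp.mapRange_add (by intro x y; simp [add_smul]), map_add, map_add, hs, ht, add_tmul]
  | single m c =>
    rw [Finsupp.mapRange_single, ofFinsuppRight_single, Finsupp.linearCombination_single,
      ← op_smul_tmul]
    simp

/-- A section of the free cover `A^(M) → M` makes `M` a retract of `A^(M)`; tensoring makes `M ⊗_A
N` a retract of `A^(M) ⊗_A N = N^(M)`. -/
theorem ofFinsuppRight_toFinsuppOfRight {s : M →ₗ[Aᵐᵒᵖ] (M →₀ Aᵐᵒᵖ)}
    (hs : Function.LeftInverse (Finsupp.linearCombination Aᵐᵒᵖ id) s) (t : BalancedTensor A M N) :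
    ofFinsuppRight A M N (toFinsuppOfRight s N t) = t := by
  induction t using induction_on with
  | h0 => simp
  | h1 m n => rw [toFinsuppOfRight_tmul, ofFinsuppRight_mapRange_smul, hs m]
  | h2 s t hs ht => rw [map_add, map_add, hs, ht]

/-- Tensoring with a projective right module is exact. -/
theorem exact_map_id [h : Module.Projective Aᵐᵒᵖ M] {f : N →ₗ[A] N'} {g : N' →ₗ[A] N''}
    (hfg : Function.Exact f g) :
    Function.Exact (map (LinearMap.id : M →ₗ[Aᵐᵒᵖ] M) f)
      (map (LinearMap.id : M →ₗ[Aᵐᵒᵖ] M) g) := by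
  obtain ⟨s, hs⟩ := h
  intro t
  constructor
  · intro ht
    -- The retraction moves the problem to `N'^(M)`, where exactness holds coordinate by coordinate.
    have h0 : (toFinsuppOfRight s N' t).mapRange g (map_zero g) = 0 := by
      rw [← toFinsuppOfRight_map, ht, map_zero]
    have h1 : ∀ m, ∃ n, f n = toFinsuppOfRight s N' t m := fun m =>
      (hfg _).1 (by simpa using DFunLike.congr_fun h0 m)
    obtain ⟨u, hu⟩ : ∃ u : M →₀ N, u.mapRange f (map_zero f) = toFinsuppOfRight s N' t := by
      classical
      choose n hn using h1
      -- A chosen preimage of `0` need not be `0`, so the choice is cut off outside the support.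
      refine ⟨Finsupp.onFinset (toFinsuppOfRight s N' t).support
        (fun m => if m ∈ (toFinsuppOfRight s N' t).support then n m else 0)
        (fun m hm => by_contra fun h => hm (if_neg h)), ?_⟩
      ext m
      by_cases hm : toFinsuppOfRight s N' t m = 0
      · simp [hm]
      · simp [hm, hn]
    refine ⟨ofFinsuppRight A M N u, ?_⟩
    rw [← ofFinsuppRight_mapRange, hu, ofFinsuppRight_toFinsuppOfRight hs]
  · rintro ⟨t, rfl⟩
    induction t using induction_on with
    | h0 => simp
    | h1 m n => rw [map_tmul, map_tmul, hfg.apply_apply_eq_zero, tmul_zero]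
    | h2 s t hs ht => rw [map_add, map_add, hs, ht, add_zero]

/-- For `s : N → A^(N)` a map of left modules, the map `M ⊗_A N → M^(N)` induced by `s`. -/
noncomputable def toFinsuppOfLeft (s : N →ₗ[A] (N →₀ A)) (M : Type*) [AddCommGroup M]
    [Module Aᵐᵒᵖ M] : BalancedTensor A M N →+ (N →₀ M) :=
  lift (AddMonoidHom.mk' (fun m => AddMonoidHom.mk'
      (fun n => (s n).mapRange (fun c => MulOpposite.op c • m) (by simp))
      (fun n n' => by ext; simp [add_smul])) (fun m m' => by ext; simp))
    (fun a m n => by ext; simp [mul_smul])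

theorem toFinsuppOfLeft_tmul (s : N →ₗ[A] (N →₀ A)) (m : M) (n : N) :
    toFinsuppOfLeft s M (tmul A m n) =
      (s n).mapRange (fun c => MulOpposite.op c • m) (by simp) := rfl

/-- The map `M^(N) → M ⊗_A N` sending `m` at position `n` to `m ⊗ n`. -/
noncomputable def ofFinsuppLeft (A : Type*) [Ring A] (M : Type*) [AddCommGroup M] [Module Aᵐᵒᵖ M]
    (N : Type*) [AddCommGroup N] [Module A N] : (N →₀ M) →+ BalancedTensor A M N :=
  Finsupp.liftAddHom (mkAddHom A M N).flip

theorem ofFinsuppLeft_single (m : M) (n : N) :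
    ofFinsuppLeft A M N (Finsupp.single n m) = tmul A m n := by
  exact (Finsupp.liftAddHom_apply_single (mkAddHom A M N).flip n m).trans (mkAddHom_apply m n)

theorem ofFinsuppLeft_mapRange_smul (t : N →₀ A) (m : M) :
    ofFinsuppLeft A M N (t.mapRange (fun c => MulOpposite.op c • m) (by simp)) =
      tmul A m (Finsupp.linearCombination A id t) := by
  induction t using Finsupp.induction_linear with
  | zero => simp [tmul_zero]
  | add s t hs ht =>
    rw [Finsupp.mapRange_add (by intro x y; simp [add_smul]), map_add, map_add, hs, ht, tmul_add]
  | single n c =>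
    rw [Finsupp.mapRange_single, ofFinsuppLeft_single, Finsupp.linearCombination_single,
      op_smul_tmul]
    simp

theorem ofFinsuppLeft_toFinsuppOfLeft {s : N →ₗ[A] (N →₀ A)}
    (hs : Function.LeftInverse (Finsupp.linearCombination A id) s) (t : BalancedTensor A M N) :
    ofFinsuppLeft A M N (toFinsuppOfLeft s M t) = t := by
  induction t using induction_on with
  | h0 => simp
  | h1 m n => rw [toFinsuppOfLeft_tmul, ofFinsuppLeft_mapRange_smul, hs n]
  | h2 s t hs ht => rw [map_add, map_add, hs, ht]

theorem projective_finsupp {R : Type*} [Ring R] (ι : Type*) (M : Type*) [AddCommGroup M]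
    [Module R M] [Module.Projective R M] : Module.Projective R (ι →₀ M) := by
  classical
  exact Module.Projective.of_equiv (finsuppLequivDFinsupp R (ι := ι) (M := M)).symm

/-- If `M` is left projective and `N` is projective, then `M ⊗_A N` is projective. -/
theorem projective_left {B : Type*} [Ring B] [Module B M] [SMulCommClass B Aᵐᵒᵖ M]
    [Module.Projective B M] [hN : Module.Projective A N] :
    Module.Projective B (BalancedTensor A M N) := by
  obtain ⟨s, hs⟩ := hN
  have := projective_finsupp (R := B) N M
  -- A section of `A^(N) → N` exhibits `M ⊗_A N` as a retract of `M^(N)`, compatibly with the left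
  -- action.
  refine Module.Projective.of_split (M := N →₀ M)
    (linearOfTmul (toFinsuppOfLeft s M) fun b m n => ?_)
    { ofFinsuppLeft A M N with map_smul' := fun b t => ?_ }
    (LinearMap.ext fun t => ofFinsuppLeft_toFinsuppOfLeft hs t)
  · simp only [toFinsuppOfLeft_tmul]
    ext
    simp [smul_comm b]
  · change ofFinsuppLeft A M N (b • t) = b • ofFinsuppLeft A M N t
    induction t using Finsupp.induction_linear with
    | zero => simp
    | add s t hs ht => rw [smul_add, map_add, map_add, smul_add, hs, ht]
    | single n m => rw [Finsupp.smul_single, ofFinsuppLeft_single, ofFinsuppLeft_single]; rfl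

/-- If `N` is right projective and `M` is projective, then `M ⊗_A N` is right projective. -/
theorem projective_right {C : Type*} [Ring C] [Module Cᵐᵒᵖ N] [SMulCommClass A Cᵐᵒᵖ N]
    [Module.Projective Cᵐᵒᵖ N] [hM : Module.Projective Aᵐᵒᵖ M] :
    Module.Projective Cᵐᵒᵖ (BalancedTensor A M N) := by
  obtain ⟨s, hs⟩ := hM
  have := projective_finsupp (R := Cᵐᵒᵖ) M N
  refine Module.Projective.of_split (M := M →₀ N)
    (linearOfTmulRight (toFinsuppOfRight s N) fun c m n => ?_)
    { ofFinsuppRight A M N with map_smul' := fun c t => ?_ }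
    (LinearMap.ext fun t => ofFinsuppRight_toFinsuppOfRight hs t)
  · simp only [toFinsuppOfRight_tmul]
    ext
    simp [smul_comm _ c]
  · change ofFinsuppRight A M N (c • t) = c • ofFinsuppRight A M N t
    induction t using Finsupp.induction_linear with
    | zero => simp
    | add s t hs ht => rw [smul_add, map_add, map_add, smul_add, hs, ht]
    | single m n => rw [Finsupp.smul_single, ofFinsuppRight_single, ofFinsuppRight_single]; rfl

/-- If `M` is finitely generated as a left `B`-module and `N` is finitely generated, then so is
`M ⊗_A N`. -/
theorem finite_left {B : Type*} [Ring B] [Module B M] [SMulCommClass B Aᵐᵒᵖ M]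
    [hM : Module.Finite B M] [hN : Module.Finite A N] :
    Module.Finite B (BalancedTensor A M N) := by
  classical
  obtain ⟨S, hS⟩ := hM
  obtain ⟨T, hT⟩ := hN
  refine ⟨(S ×ˢ T).image fun p => tmul A p.1 p.2, ?_⟩
  set U := Submodule.span B
    (((S ×ˢ T).image fun p => tmul A p.1 p.2 : Finset (BalancedTensor A M N)) :
      Set (BalancedTensor A M N)) with hU
  have h1 : ∀ n ∈ T, ∀ m : M, tmul A m n ∈ U := by
    intro n hn m
    have hm : m ∈ Submodule.span B (S : Set M) := hS ▸ Submodule.mem_top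
    induction hm using Submodule.span_induction with
    | mem m hm =>
      exact Submodule.subset_span (Finset.mem_coe.2 (Finset.mem_image.2
        ⟨(m, n), Finset.mem_product.2 ⟨hm, hn⟩, rfl⟩))
    | zero => rw [zero_tmul]; exact U.zero_mem
    | add x y _ _ hx hy => rw [add_tmul]; exact U.add_mem hx hy
    | smul b x _ hx => rw [← smul_tmul_left]; exact U.smul_mem b hx
  refine (Submodule.eq_top_iff').2 fun t => ?_
  induction t using induction_on with
  | h0 => exact U.zero_mem
  | h2 s t hs ht => exact U.add_mem hs ht
  | h1 m n =>
    have hn : n ∈ Submodule.span A (T : Set N) := hT ▸ Submodule.mem_top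
    -- `m` has to vary: in the scalar case `a` crosses the tensor sign and acts on `m`.
    induction hn using Submodule.span_induction generalizing m with
    | mem n hn => exact h1 n hn m
    | zero => rw [tmul_zero]; exact U.zero_mem
    | add x y _ _ hx hy => rw [tmul_add]; exact U.add_mem (hx m) (hy m)
    | smul a x _ hx => rw [← op_smul_tmul]; exact hx _

end Projective

end BalancedTensor

/-! ### Dimension shifting in acyclic complexes of projectives. -/

section Dimension

variable {R : Type u} [Ring R] {M₁ M₂ M₃ : Type u} [AddCommGroup M₁] [Module R M₁]
  [AddCommGroup M₂] [Module R M₂] [AddCommGroup M₃] [Module R M₃]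

open CategoryTheory in
theorem Function.Exact.moduleCat_shortExact {f : M₁ →ₗ[R] M₂} {g : M₂ →ₗ[R] M₃}
    (h : Function.Exact f g) (hf : Function.Injective f) (hg : Function.Surjective g) :
    (ShortComplex.moduleCatMk f g h.linearMap_comp_eq_zero).ShortExact :=
  ModuleCat.shortComplex_shortExact _ h hf hg

open CategoryTheory in
theorem Module.Projective.hasProjectiveDimensionLE [Module.Projective R M₁] (n : ℕ) :
    HasProjectiveDimensionLE (ModuleCat.of R M₁) n := by
  have : CategoryTheory.Projective (ModuleCat.of R M₁) := (IsProjective.iff_projective M₁).1 ‹_›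
  exact hasProjectiveDimensionLT_of_ge _ 1 _ (by omega)

open CategoryTheory in
theorem Module.Projective.of_hasProjectiveDimensionLE_zero
    (h : HasProjectiveDimensionLE (ModuleCat.of R M₁) 0) : Module.Projective R M₁ :=
  (IsProjective.iff_projective M₁).2 (projective_iff_hasProjectiveDimensionLT_one.2 h)

variable (P : ℤ → Type u) [∀ i, AddCommGroup (P i)] [∀ i, Module R (P i)]
  (d : ∀ i : ℤ, P i →ₗ[R] P (i + 1))

open CategoryTheory in
/-- In an acyclic complex of projective modules whose cokernels have bounded projective dimension,
all cokernels are projective. -/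
theorem projective_coker_of_exact (hP : ∀ i, Module.Projective R (P i))
    (hd : ∀ i, Function.Exact (d i) (d (i + 1))) (n : ℕ)
    (hn : ∀ i, HasProjectiveDimensionLE (ModuleCat.of R (P (i + 1) ⧸ LinearMap.range (d i))) n)
    (i : ℤ) : Module.Projective R (P (i + 1) ⧸ LinearMap.range (d i)) := by
  induction n with
  | zero => exact Module.Projective.of_hasProjectiveDimensionLE_zero (hn i)
  | succ n ih =>
    refine ih fun j => ?_
    have hle : LinearMap.range (d j) ≤ LinearMap.ker (d (j + 1)) :=
      le_of_eq (LinearMap.exact_iff.1 (hd j)).symm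
    -- The sequence `0 → coker d_j → P_{j+2} → coker d_{j+1} → 0` makes each cokernel a first syzygy
    -- of the next, so a bound valid for all indices drops by one.
    have hex : Function.Exact ((LinearMap.range (d j)).liftQ (d (j + 1)) hle)
        (LinearMap.range (d (j + 1))).mkQ := by
      rw [LinearMap.exact_iff, Submodule.range_liftQ, Submodule.ker_mkQ]
    have hinj : Function.Injective ((LinearMap.range (d j)).liftQ (d (j + 1)) hle) := by
      rw [← LinearMap.ker_eq_bot, Submodule.ker_liftQ, LinearMap.exact_iff.1 (hd j),
        Submodule.mkQ_map_self]
    exact (hex.moduleCat_shortExact hinj (Submodule.mkQ_surjective _)).hasProjectiveDimensionLT_X₁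
      (n + 1) (Module.Projective.hasProjectiveDimensionLE n) (hn (j + 1))

open CategoryTheory in
/-- For an acyclic complex `P` of projective modules and a module `I` of finite injective dimension,
the complex `Hom(P, I)` is acyclic. -/
theorem exists_extension_of_hasInjectiveDimensionLE (hP : ∀ i, Module.Projective R (P i))
    (hd : ∀ i, Function.Exact (d i) (d (i + 1))) (n : ℕ) :
    ∀ (I : Type u) [AddCommGroup I] [Module R I],
      HasInjectiveDimensionLE (ModuleCat.of R I) n →
      ∀ (i : ℤ) (ψ : P (i + 1) →ₗ[R] I), ψ ∘ₗ d i = 0 →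
        ∃ χ : P (i + 1 + 1) →ₗ[R] I, χ ∘ₗ d (i + 1) = ψ := by
  induction n with
  | zero =>
    intro I _ _ hI i ψ hψ
    have hinj : Module.Injective R I :=
      (Module.injective_iff_injective_object R I).2
        (injective_iff_hasInjectiveDimensionLT_one.2 hI)
    -- `ψ` factors through `P (i + 1) / ker d`, which embeds in `P (i + 1 + 1)`; injectivity of `I`
    -- extends it.
    have hle : LinearMap.ker (d (i + 1)) ≤ LinearMap.ker ψ := by
      rw [LinearMap.exact_iff.1 (hd i)]
      exact LinearMap.range_le_ker_iff.2 hψ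
    obtain ⟨χ, hχ⟩ := hinj.out ((LinearMap.ker (d (i + 1))).liftQ (d (i + 1)) le_rfl)
      (LinearMap.ker_eq_bot.1 (Submodule.ker_liftQ_eq_bot _ _ _ le_rfl))
      ((LinearMap.ker (d (i + 1))).liftQ ψ hle)
    exact ⟨χ, LinearMap.ext fun x => hχ (Submodule.Quotient.mk x)⟩
  | succ n ih =>
    intro I _ _ hI i ψ hψ
    -- In `0 → I → J → J/I → 0` with `J` injective, both `J` and `J/I` have injective dimension at
    -- most `n`.
    obtain ⟨⟨J, hJ, f, hf⟩⟩ := EnoughInjectives.presentation (ModuleCat.of R I)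
    let ι : I →ₗ[R] J := f.hom
    have hι : Function.Injective ι := (ModuleCat.mono_iff_injective f).1 hf
    let π := (LinearMap.range ι).mkQ
    have hex : Function.Exact ι π := LinearMap.exact_map_mkQ_range ι
    have hπ : Function.Surjective π := Submodule.mkQ_surjective _
    have hI' : HasInjectiveDimensionLE (ModuleCat.of R (J ⧸ LinearMap.range ι)) n :=
      (hex.moduleCat_shortExact hι hπ).hasInjectiveDimensionLT_X₃ (n + 1)
        (hasInjectiveDimensionLT_of_ge J 1 _ (by omega)) hI
    have hJ0 : HasInjectiveDimensionLE (ModuleCat.of R J) n :=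
      hasInjectiveDimensionLT_of_ge J 1 _ (by omega)
    -- `χ` extends `ψ` with values only in `J`. Modulo `I` it kills the image of `d (i + 1)`, so it
    -- extends one step further to `ω`, which lifts to `ω'` with values in `J`. Subtracting `ω' ∘ d`
    -- pushes `χ` into `I` without changing `χ ∘ d (i + 1)`, as `d ∘ d = 0`.
    obtain ⟨χ, hχ⟩ := ih J hJ0 i (ι ∘ₗ ψ) (by rw [LinearMap.comp_assoc, hψ, LinearMap.comp_zero])
    obtain ⟨ω, hω⟩ := ih _ hI' (i + 1) (π ∘ₗ χ) (by
      rw [LinearMap.comp_assoc, hχ, ← LinearMap.comp_assoc, hex.linearMap_comp_eq_zero,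
        LinearMap.zero_comp])
    obtain ⟨ω', hω'⟩ := Module.projective_lifting_property π ω hπ
    have hmem : ∀ x, (χ - ω' ∘ₗ d (i + 1 + 1)) x ∈ LinearMap.range ι := by
      intro x
      refine (hex _).1 ?_
      rw [← LinearMap.comp_apply, LinearMap.comp_sub, ← LinearMap.comp_assoc, hω', hω, sub_self,
        LinearMap.zero_apply]
    refine ⟨(LinearEquiv.ofInjective ι hι).symm.toLinearMap ∘ₗ
      (χ - ω' ∘ₗ d (i + 1 + 1)).codRestrict _ hmem, LinearMap.ext fun x => hι ?_⟩
    have h1 : ι ((LinearEquiv.ofInjective ι hι).symm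
        ((χ - ω' ∘ₗ d (i + 1 + 1)).codRestrict _ hmem (d (i + 1) x))) =
        (χ - ω' ∘ₗ d (i + 1 + 1)) (d (i + 1) x) :=
      congrArg Subtype.val ((LinearEquiv.ofInjective ι hι).apply_symm_apply _)
    refine h1.trans ?_
    rw [LinearMap.sub_apply, LinearMap.comp_apply, (hd (i + 1)).apply_apply_eq_zero, map_zero,
      sub_zero]
    exact LinearMap.congr_fun hχ x

end Dimension

namespace BalancedTensor

/-! ### Compatibility of tensoring with cokernels and isomorphisms. -/

section Complex

variable {A : Type*} [Ring A] {B : Type*} [Ring B]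
  (M : Type*) [AddCommGroup M] [Module Aᵐᵒᵖ M] [Module B M] [SMulCommClass B Aᵐᵒᵖ M]
  {N : Type*} [AddCommGroup N] [Module A N] {N' : Type*} [AddCommGroup N'] [Module A N']

/-- `M ⊗_A -` commutes with cokernels, for `M` projective as a right module. -/
noncomputable def cokerEquiv [Module.Projective Aᵐᵒᵖ M] (f : N →ₗ[A] N') :
    (BalancedTensor A M N' ⧸ LinearMap.range (lTensor B M f)) ≃ₗ[B]
      BalancedTensor A M (N' ⧸ LinearMap.range f) :=
  (Submodule.quotEquivOfEq _ _ (LinearMap.exact_iff.1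
    (exact_map_id (M := M) (LinearMap.exact_map_mkQ_range f) :
      Function.Exact (lTensor B M f) (lTensor B M (LinearMap.range f).mkQ))).symm).trans
  (LinearMap.quotKerEquivOfSurjective (lTensor B M (LinearMap.range f).mkQ)
    (map_surjective Function.surjective_id (Submodule.mkQ_surjective _)))

/-- The isomorphism `M ⊗_A N ≅ M ⊗_A N'` induced by `N ≅ N'`. -/
def congrRight (e : N ≃ₗ[A] N') : BalancedTensor A M N ≃ₗ[B] BalancedTensor A M N' :=
  LinearEquiv.ofLinearMap (lTensor B M e.toLinearMap) (lTensor B M e.symm.toLinearMap)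
    (LinearMap.toAddMonoidHom_injective (addHom_ext fun m n => by
      change tmul A m (e (e.symm n)) = tmul A m n
      rw [e.apply_symm_apply]))
    (LinearMap.toAddMonoidHom_injective (addHom_ext fun m n => by
      change tmul A m (e.symm (e n)) = tmul A m n
      rw [e.symm_apply_apply]))

end Complex

/-! ### Bimodules that are projective over `A ⊗_k Bᵐᵒᵖ`. -/

section Enveloping

variable {k : Type w} [Field k] {A : Type u} [Ring A] [Algebra k A] {B : Type u} [Ring B]
  [Algebra k B]

/-- The map `A ⊗_k Bᵐᵒᵖ → A ⊗_k W`, `a ⊗ b ↦ a ⊗ b w`. -/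
noncomputable def envelopingSMul (A : Type u) [Ring A] [Algebra k A] {W : Type u} [AddCommGroup W]
    [Module B W] [Module k W] [IsScalarTower k B W] (w : W) : A ⊗[k] Bᵐᵒᵖ →ₗ[k] A ⊗[k] W :=
  LinearMap.lTensor A
    ((LinearMap.toSpanSingleton B W w).restrictScalars k ∘ₗ
      (MulOpposite.opLinearEquiv k).symm.toLinearMap)

theorem envelopingSMul_tmul {W : Type u} [AddCommGroup W]
    [Module B W] [Module k W] [IsScalarTower k B W] (w : W) (a : A) (b : Bᵐᵒᵖ) :
    envelopingSMul A w (a ⊗ₜ[k] b) = a ⊗ₜ[k] (b.unop • w) := rfl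

theorem envelopingSMul_add {W : Type u} [AddCommGroup W]
    [Module B W] [Module k W] [IsScalarTower k B W] (w w' : W) (t : A ⊗[k] Bᵐᵒᵖ) :
    envelopingSMul A (w + w') t = envelopingSMul A w t + envelopingSMul A w' t := by
  induction t using TensorProduct.induction_on with
  | zero => simp
  | tmul a b => simp only [envelopingSMul_tmul, smul_add, TensorProduct.tmul_add]
  | add s t hs ht => simp only [map_add, hs, ht]; abel

/-- This is the balancing over `B` needed for a map out of `P ⊗_B W` in
`projective_of_projective_enveloping`. -/
theorem envelopingSMul_smul {W : Type u} [AddCommGroup W]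
    [Module B W] [Module k W] [IsScalarTower k B W] (b : B) (w : W) (t : A ⊗[k] Bᵐᵒᵖ) :
    envelopingSMul A w ((1 ⊗ₜ[k] MulOpposite.op b) * t) = envelopingSMul A (b • w) t := by
  induction t using TensorProduct.induction_on with
  | zero => simp
  | tmul a c =>
    rw [Algebra.TensorProduct.tmul_mul_tmul, envelopingSMul_tmul, envelopingSMul_tmul, one_mul,
      MulOpposite.unop_mul, MulOpposite.unop_op, mul_smul]
  | add s t hs ht => simp only [mul_add, map_add, hs, ht]

theorem envelopingSMul_mul {W : Type u} [AddCommGroup W]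
    [Module B W] [Module k W] [IsScalarTower k B W] (a : A) (w : W) (t : A ⊗[k] Bᵐᵒᵖ) :
    envelopingSMul A w ((a ⊗ₜ[k] 1) * t) = a • envelopingSMul A w t := by
  induction t using TensorProduct.induction_on with
  | zero => simp
  | tmul a' c =>
    rw [Algebra.TensorProduct.tmul_mul_tmul, envelopingSMul_tmul, envelopingSMul_tmul, one_mul,
      TensorProduct.smul_tmul', smul_eq_mul]
  | add s t hs ht => simp only [mul_add, map_add, smul_add, hs, ht]

/-- A bimodule which is projective over `A ⊗_k Bᵐᵒᵖ` is projective as a right module. -/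
theorem projective_right_of_projective_enveloping {P : Type u} [AddCommGroup P]
    [Module (A ⊗[k] Bᵐᵒᵖ) P] [Module Bᵐᵒᵖ P]
    (hr : ∀ (b : Bᵐᵒᵖ) (p : P), ((1 : A) ⊗ₜ[k] b) • p = b • p)
    [hP : Module.Projective (A ⊗[k] Bᵐᵒᵖ) P] : Module.Projective Bᵐᵒᵖ P := by
  obtain ⟨s, hs⟩ := hP
  -- After swapping the factors, `Bᵐᵒᵖ` acts on the left one, and `Bᵐᵒᵖ ⊗_k A` is the base change of
  -- a vector space, hence projective.
  let e : (Bᵐᵒᵖ ⊗[k] A) ≃ₗ[k] (A ⊗[k] Bᵐᵒᵖ) := TensorProduct.comm k _ _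
  have := projective_finsupp (R := Bᵐᵒᵖ) P (Bᵐᵒᵖ ⊗[k] A)
  have he : ∀ (b : Bᵐᵒᵖ) (t : A ⊗[k] Bᵐᵒᵖ), e.symm ((1 ⊗ₜ[k] b) * t) = b • e.symm t := by
    intro b t
    induction t using TensorProduct.induction_on with
    | zero => simp
    | tmul a c => simp [e, TensorProduct.smul_tmul']
    | add s t hs ht => simp only [mul_add, map_add, smul_add, hs, ht]
  have he' : ∀ (b : Bᵐᵒᵖ) (t : Bᵐᵒᵖ ⊗[k] A), e (b • t) = (1 ⊗ₜ[k] b) * e t := fun b t => by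
    have h := he b (e t)
    rw [e.symm_apply_apply] at h
    rw [← h, e.apply_symm_apply]
  refine Module.Projective.of_split (M := P →₀ Bᵐᵒᵖ ⊗[k] A)
    { toFun := fun p => (s p).mapRange e.symm (map_zero _)
      map_add' := fun p q => by rw [map_add, Finsupp.mapRange_add (map_add _)]
      map_smul' := fun b p => by
        ext q
        simp [← hr, he] }
    { toFun := fun t => Finsupp.linearCombination (A ⊗[k] Bᵐᵒᵖ) id (t.mapRange e (map_zero _))
      map_add' := fun p q => by rw [Finsupp.mapRange_add (map_add _), map_add]
      map_smul' := fun b t => ?_ }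
    (LinearMap.ext fun p => ?_)
  · have : (b • t).mapRange e (map_zero _) =
        ((1 : A) ⊗ₜ[k] b) • t.mapRange e (map_zero _) := by
      ext q
      simp [he']
    rw [this, map_smul, hr]
    rfl
  · have : ((s p).mapRange e.symm (map_zero _)).mapRange e (map_zero _) = s p := by
      ext q
      simp
    exact (congrArg _ this).trans (hs p)

variable {P : Type u} [AddCommGroup P] [Module (A ⊗[k] Bᵐᵒᵖ) P] [Module A P] [Module Bᵐᵒᵖ P]
  [SMulCommClass A Bᵐᵒᵖ P]

/-- If the `A`-`B`-bimodule `P` is projective over `A ⊗_k Bᵐᵒᵖ`, then `P ⊗_B W` is projective. -/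
theorem projective_of_projective_enveloping
    (hl : ∀ (a : A) (p : P), (a ⊗ₜ[k] (1 : Bᵐᵒᵖ)) • p = a • p)
    (hr : ∀ (b : Bᵐᵒᵖ) (p : P), ((1 : A) ⊗ₜ[k] b) • p = b • p)
    [hP : Module.Projective (A ⊗[k] Bᵐᵒᵖ) P] (W : Type u) [AddCommGroup W] [Module B W] :
    Module.Projective A (BalancedTensor B P W) := by
  -- `W` becomes a `k`-vector space through `B`, so that `A ⊗_k W` is projective over `A`.
  let : Module k W := Module.compHom W (algebraMap k B)
  have hk : ∀ (c : k) (x : W), c • x = algebraMap k B c • x := fun _ _ => rfl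
  have : IsScalarTower k B W :=
    ⟨fun c b x => by rw [hk, Algebra.smul_def, mul_smul]⟩
  obtain ⟨s, hs⟩ := hP
  have := projective_finsupp (R := A) P (A ⊗[k] W)
  -- `P` is a retract of `(A ⊗_k Bᵐᵒᵖ)^(P)`, so `P ⊗_B W` is a retract of `(A ⊗_k W)^(P)`; `φ` is
  -- the inclusion and `ψ` below the retraction.
  let φ : BalancedTensor B P W →+ (P →₀ A ⊗[k] W) :=
    lift (AddMonoidHom.mk' (fun p => AddMonoidHom.mk'
      (fun x => (s p).mapRange (envelopingSMul A x) (map_zero _))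
      (fun x x' => by ext q; simp [envelopingSMul_add]))
      (fun p p' => by ext x q; simp))
      (fun b p x => by
        ext q
        simp [← hr, envelopingSMul_smul])
  have hφ : ∀ p x, φ (tmul B p x) = (s p).mapRange (envelopingSMul A x) (map_zero _) :=
    fun _ _ => rfl
  let ψ₀ (p : P) : A ⊗[k] W →+ BalancedTensor B P W :=
    TensorProduct.liftAddHom
      (AddMonoidHom.mk' (fun a => (mkAddHom B P W (a • p)))
        (fun a a' => by rw [add_smul, map_add]))
      -- In `A ⊗_k Bᵐᵒᵖ` one has `c ⊗ 1 = 1 ⊗ c` for `c` in `k`, so the left and right actions of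
      -- `k` on `P` agree.
      (fun c a x => by
        change tmul B ((c • a) • p) x = tmul B (a • p) (c • x)
        rw [hk, ← op_smul_tmul, ← hr, ← hl, ← hl, ← mul_smul,
          Algebra.TensorProduct.tmul_mul_tmul, one_mul, mul_one, ← MulOpposite.algebraMap_apply,
          Algebra.algebraMap_eq_smul_one, TensorProduct.tmul_smul, TensorProduct.smul_tmul'])
  have hψ₀ : ∀ p a x, ψ₀ p (a ⊗ₜ[k] x) = tmul B (a • p) x := fun _ _ _ => rfl
  let ψ : (P →₀ A ⊗[k] W) →+ BalancedTensor B P W := Finsupp.liftAddHom ψ₀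
  have hψ : ∀ p t, ψ (Finsupp.single p t) = ψ₀ p t := Finsupp.liftAddHom_apply_single ψ₀
  have hψφ : ∀ (t : P →₀ A ⊗[k] Bᵐᵒᵖ) (x : W),
      ψ (t.mapRange (envelopingSMul A x) (map_zero _)) =
        tmul B (Finsupp.linearCombination _ id t) x := by
    intro t x
    induction t using Finsupp.induction_linear with
    | zero => simp [zero_tmul]
    | add s t hs ht => rw [Finsupp.mapRange_add (map_add _), map_add, map_add, hs, ht, add_tmul]
    | single p t =>
      rw [Finsupp.mapRange_single, hψ, Finsupp.linearCombination_single, id_eq]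
      induction t using TensorProduct.induction_on with
      | zero =>
        have h0 : (0 : A ⊗[k] Bᵐᵒᵖ) • p = 0 := zero_smul (A ⊗[k] Bᵐᵒᵖ) p
        rw [map_zero, map_zero]
        exact ((congrArg (tmul B · x) h0).trans (zero_tmul x)).symm
      | add s t hs ht => rw [map_add, map_add, add_smul, add_tmul, hs, ht]
      | tmul a b =>
        rw [envelopingSMul_tmul, hψ₀, ← op_smul_tmul, ← hr, ← hl, ← mul_smul,
          Algebra.TensorProduct.tmul_mul_tmul, one_mul, mul_one, MulOpposite.op_unop]
  refine Module.Projective.of_split (M := P →₀ A ⊗[k] W)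
    (linearOfTmul φ fun a p x => ?_) { ψ with map_smul' := fun a t => ?_ }
    (LinearMap.ext fun t => ?_)
  · rw [hφ, hφ, ← hl]
    ext q
    simp [envelopingSMul_mul]
  · change ψ (a • t) = a • ψ t
    induction t using Finsupp.induction_linear with
    | zero => simp
    | add s t hs ht => rw [smul_add, map_add, map_add, smul_add, hs, ht]
    | single p t =>
      rw [Finsupp.smul_single, hψ, hψ]
      induction t using TensorProduct.induction_on with
      | zero => simp
      | add s t hs ht => rw [smul_add, map_add, map_add, smul_add, hs, ht]
      | tmul a' x =>
        rw [TensorProduct.smul_tmul', hψ₀, hψ₀, smul_tmul_left, smul_eq_mul, mul_smul]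
  · change ψ (φ t) = t
    induction t using induction_on with
    | h0 => simp
    | h1 p x => rw [hφ, hψφ, hs p]
    | h2 s t hs ht => rw [map_add, map_add, hs, ht]

end Enveloping

end BalancedTensor

/-! ### Tensoring with bimodules of finite projective dimension. -/

namespace BalancedTensor

/-- A short exact sequence of bimodules which splits on the right stays exact after tensoring. -/
theorem exact_map_of_split {A : Type*} [Ring A] {K F P : Type*} [AddCommGroup K] [Module Aᵐᵒᵖ K]
    [AddCommGroup F] [Module Aᵐᵒᵖ F] [AddCommGroup P] [Module Aᵐᵒᵖ P]
    {f : K →ₗ[Aᵐᵒᵖ] F} {g : F →ₗ[Aᵐᵒᵖ] P} {r : F →ₗ[Aᵐᵒᵖ] K} {s : P →ₗ[Aᵐᵒᵖ] F}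
    (hgf : ∀ x, g (f x) = 0) (hrf : ∀ x, r (f x) = x) (hsum : ∀ x, f (r x) + s (g x) = x)
    (N : Type*) [AddCommGroup N] [Module A N] :
    Function.Exact (map f (LinearMap.id : N →ₗ[A] N)) (map g (LinearMap.id : N →ₗ[A] N)) ∧
      Function.Injective (map f (LinearMap.id : N →ₗ[A] N)) := by
  -- The splitting identities survive tensoring as identities of additive maps; `r` and `s` need not
  -- respect any left action.
  have hrf' : ∀ t : BalancedTensor A K N, map r LinearMap.id (map f LinearMap.id t) = t := by
    intro t
    induction t using induction_on with
    | h0 => simp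
    | h1 m n => rw [map_tmul, map_tmul, hrf]; rfl
    | h2 s t hs ht => rw [map_add, map_add, hs, ht]
  refine ⟨fun t => ⟨fun ht => ⟨map r LinearMap.id t, ?_⟩, ?_⟩, Function.LeftInverse.injective hrf'⟩
  · have h : ∀ t : BalancedTensor A F N, map f LinearMap.id (map r LinearMap.id t) +
        map s LinearMap.id (map g LinearMap.id t) = t := by
      intro t
      induction t using induction_on with
      | h0 => simp
      | h1 m n =>
        simp only [map_tmul, LinearMap.id_apply]
        rw [← add_tmul, hsum]
      | h2 s t hs ht =>
        simp only [map_add]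
        rw [add_add_add_comm, hs, ht]
    have h' := h t
    rwa [ht, map_zero, add_zero] at h'
  · rintro ⟨t, rfl⟩
    induction t using induction_on with
    | h0 => simp
    | h1 m n => rw [map_tmul, map_tmul, hgf, zero_tmul]
    | h2 s t hs ht => rw [map_add, map_add, hs, ht, add_zero]

section Enveloping

variable {k : Type w} [Field k] {A : Type u} [Ring A] [Algebra k A] {B : Type u} [Ring B]
  [Algebra k B]

open CategoryTheory in
/-- If the bimodule `P` is right projective, the projective dimension of `P ⊗_B W` is at most that
of `P` as a bimodule. -/
theorem hasProjectiveDimensionLE_of_enveloping (W : Type u) [AddCommGroup W] [Module B W] (n : ℕ) :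
    ∀ (P : Type u) [AddCommGroup P] [Module (A ⊗[k] Bᵐᵒᵖ) P] [Module A P] [Module Bᵐᵒᵖ P]
      [SMulCommClass A Bᵐᵒᵖ P] [Module.Projective Bᵐᵒᵖ P],
      (∀ (a : A) (p : P), (a ⊗ₜ[k] (1 : Bᵐᵒᵖ)) • p = a • p) →
      (∀ (b : Bᵐᵒᵖ) (p : P), ((1 : A) ⊗ₜ[k] b) • p = b • p) →
      HasProjectiveDimensionLE (ModuleCat.of (A ⊗[k] Bᵐᵒᵖ) P) n →
      HasProjectiveDimensionLE (ModuleCat.of A (BalancedTensor B P W)) n := by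
  induction n with
  | zero =>
    intro P _ _ _ _ _ _ hl hr hP
    have := Module.Projective.of_hasProjectiveDimensionLE_zero hP
    have := projective_of_projective_enveloping hl hr W
    exact Module.Projective.hasProjectiveDimensionLE 0
  | succ n ih =>
    intro P _ _ _ _ _ _ hl hr hP
    -- A free cover of `P`, kept only as an abstract module: the concrete `P →₀ A ⊗[k] Bᵐᵒᵖ` has an
    -- `A`-action of its own, which would compete with the restricted one chosen below.
    obtain ⟨F, _, _, hF, g, hg⟩ : ∃ (F : Type u) (_ : AddCommGroup F)
        (_ : Module (A ⊗[k] Bᵐᵒᵖ) F) (_ : Module.Projective (A ⊗[k] Bᵐᵒᵖ) F)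
        (g : F →ₗ[A ⊗[k] Bᵐᵒᵖ] P), Function.Surjective g :=
      ⟨P →₀ A ⊗[k] Bᵐᵒᵖ, inferInstance, inferInstance, inferInstance,
        Finsupp.linearCombination _ id, Finsupp.linearCombination_id_surjective _ _⟩
    obtain ⟨K, _, _, f, hf, hfg⟩ : ∃ (K : Type u) (_ : AddCommGroup K)
        (_ : Module (A ⊗[k] Bᵐᵒᵖ) K) (f : K →ₗ[A ⊗[k] Bᵐᵒᵖ] F),
        Function.Injective f ∧ Function.Exact f g :=
      ⟨LinearMap.ker g, inferInstance, inferInstance, (LinearMap.ker g).subtype,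
        Subtype.val_injective, g.exact_subtype_ker_map⟩
    let iA : A →+* A ⊗[k] Bᵐᵒᵖ :=
      (Algebra.TensorProduct.includeLeft : A →ₐ[k] A ⊗[k] Bᵐᵒᵖ).toRingHom
    let iB : Bᵐᵒᵖ →+* A ⊗[k] Bᵐᵒᵖ :=
      (Algebra.TensorProduct.includeRight : Bᵐᵒᵖ →ₐ[k] A ⊗[k] Bᵐᵒᵖ).toRingHom
    have hcomm : ∀ a b, iA a * iB b = iB b * iA a := fun a b => by
      simp [iA, iB]
    let : Module A F := Module.compHom F iA
    let : Module Bᵐᵒᵖ F := Module.compHom F iB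
    let : Module A K := Module.compHom K iA
    let : Module Bᵐᵒᵖ K := Module.compHom K iB
    have hlF : ∀ (a : A) (x : F), (a ⊗ₜ[k] (1 : Bᵐᵒᵖ)) • x = a • x := fun _ _ => rfl
    have hrF : ∀ (b : Bᵐᵒᵖ) (x : F), ((1 : A) ⊗ₜ[k] b) • x = b • x := fun _ _ => rfl
    have hlK : ∀ (a : A) (x : K), (a ⊗ₜ[k] (1 : Bᵐᵒᵖ)) • x = a • x := fun _ _ => rfl
    have hrK : ∀ (b : Bᵐᵒᵖ) (x : K), ((1 : A) ⊗ₜ[k] b) • x = b • x := fun _ _ => rfl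
    have : SMulCommClass A Bᵐᵒᵖ F := ⟨fun a b x => by
      change iA a • iB b • x = iB b • iA a • x
      rw [← mul_smul, hcomm, mul_smul]⟩
    have : SMulCommClass A Bᵐᵒᵖ K := ⟨fun a b x => by
      change iA a • iB b • x = iB b • iA a • x
      rw [← mul_smul, hcomm, mul_smul]⟩
    have := projective_right_of_projective_enveloping hrF
    let f' : K →ₗ[Bᵐᵒᵖ] F := ⟨⟨f, map_add f⟩, fun b x => by
      change f (b • x) = b • f x
      rw [← hrK, map_smul, hrF]⟩
    let g' : F →ₗ[Bᵐᵒᵖ] P := ⟨⟨g, map_add g⟩, fun b x => by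
      change g (b • x) = b • g x
      rw [← hrF, map_smul, hr]⟩
    -- Right projectivity of `P` splits the cover as right modules.
    obtain ⟨s, hs⟩ := Module.projective_lifting_property g' LinearMap.id hg
    have hs' : ∀ p, g (s p) = p := fun p => LinearMap.congr_fun hs p
    have hgf : ∀ x, g' (f' x) = 0 := hfg.apply_apply_eq_zero
    have hmem : ∀ x, ∃ y, f' y = x - s (g' x) := fun x => (hfg _).1 (by
      rw [map_sub, hs']
      exact sub_self _)
    choose r₀ hr₀ using hmem
    -- Injectivity of `f` makes the chosen preimages unique, hence additive and linear in `x`.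
    let r : F →ₗ[Bᵐᵒᵖ] K :=
      { toFun := r₀
        map_add' := fun x y => hf (by
          change f' _ = f' _
          rw [map_add, hr₀, hr₀, hr₀, map_add, map_add, add_sub_add_comm])
        map_smul' := fun b x => hf (by
          change f' _ = f' (b • r₀ x)
          rw [map_smul, hr₀, hr₀, map_smul, map_smul, smul_sub]) }
    have hrf : ∀ x, r (f' x) = x := fun x => hf (by
      change f' (r₀ (f' x)) = f' x
      rw [hr₀, hgf, map_zero, sub_zero])
    have hsum : ∀ x, f' (r x) + s (g' x) = x := fun x => by
      change f' (r₀ x) + s (g' x) = x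
      rw [hr₀, sub_add_cancel]
    -- The kernel is a right summand of `F`, so the induction hypothesis applies to it.
    have : Module.Projective Bᵐᵒᵖ K := Module.Projective.of_split f' r (LinearMap.ext hrf)
    have hK : HasProjectiveDimensionLE (ModuleCat.of (A ⊗[k] Bᵐᵒᵖ) K) n :=
      (hfg.moduleCat_shortExact hf hg).hasProjectiveDimensionLT_X₁ (n + 1)
        (Module.Projective.hasProjectiveDimensionLE n) hP
    have hex := exact_map_of_split hgf hrf hsum W
    let fW : BalancedTensor B K W →ₗ[A] BalancedTensor B F W := rTensor W f' (fun a x => by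
      change f (a • x) = a • f x
      rw [← hlK, map_smul, hlF])
    let gW : BalancedTensor B F W →ₗ[A] BalancedTensor B P W := rTensor W g' (fun a x => by
      change g (a • x) = a • g x
      rw [← hlF, map_smul, hl])
    have hexW : Function.Exact fW gW := hex.1
    have := projective_of_projective_enveloping hlF hrF W
    exact (hexW.moduleCat_shortExact hex.2
      (map_surjective hg Function.surjective_id)).hasProjectiveDimensionLT_X₃ (n + 1)
        (ih K hlK hrK hK) (Module.Projective.hasProjectiveDimensionLE _)

end Enveloping

end BalancedTensor

/-! ### Gorenstein-projective modules and the main theorem. -/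

/-- If `G` has finite injective dimension as a left module and the bimodule `X` is projective on
both sides, then `X ⊗_L -` preserves Gorenstein-projective modules. -/
theorem IsGorensteinProjective.balancedTensor {L G X V : Type u} [Ring L] [Ring G]
    (hG : ∃ n : ℕ, CategoryTheory.HasInjectiveDimensionLE (ModuleCat.of G G) n)
    [AddCommGroup X] [Module G X] [Module Lᵐᵒᵖ X] [SMulCommClass G Lᵐᵒᵖ X]
    [Module.Projective G X] [Module.Projective Lᵐᵒᵖ X]
    [AddCommGroup V] [Module L V] (hV : IsGorensteinProjective L V) :
    IsGorensteinProjective G (BalancedTensor L X V) := by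
  obtain ⟨n, hn⟩ := hG
  obtain ⟨P, d, hP, hd, -, ⟨e⟩⟩ := hV
  have hP' : ∀ i, Module.Projective G (BalancedTensor L X (P i)) := fun i =>
    BalancedTensor.projective_left
  have hd' : ∀ i, Function.Exact (BalancedTensor.lTensor G X (d i))
      (BalancedTensor.lTensor G X (d (i + 1))) := fun i =>
    BalancedTensor.exact_map_id (hd i)
  refine ⟨fun i => ModuleCat.of G (BalancedTensor L X (P i)),
    fun i => BalancedTensor.lTensor G X (d i), hP', hd', fun i φ => ⟨fun h => ?_, ?_⟩,
    ⟨(BalancedTensor.congrRight X e).trans (BalancedTensor.cokerEquiv X (d 0)).symm⟩⟩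
  · exact exists_extension_of_hasInjectiveDimensionLE (fun i => BalancedTensor L X (P i))
      (fun i => BalancedTensor.lTensor G X (d i)) hP' hd' n G hn i φ h
  · rintro ⟨χ, rfl⟩
    exact (LinearMap.comp_assoc _ _ _).trans
      ((congrArg χ.comp (hd' i).linearMap_comp_eq_zero).trans (LinearMap.comp_zero χ))

open CategoryTheory in
/-- If `P ⊗_L W` has projective dimension at most `n` for all `W`, with `P` projective on both
sides, then `P ⊗_L V` is projective for every Gorenstein-projective module `V`. -/
theorem IsGorensteinProjective.projective_balancedTensor {L G P V : Type u} [Ring L] [Ring G]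
    [AddCommGroup P] [Module G P] [Module Lᵐᵒᵖ P] [SMulCommClass G Lᵐᵒᵖ P]
    [Module.Projective G P] [Module.Projective Lᵐᵒᵖ P]
    [AddCommGroup V] [Module L V] (hV : IsGorensteinProjective L V) (n : ℕ)
    (hn : ∀ (W : Type u) [AddCommGroup W] [Module L W],
      HasProjectiveDimensionLE (ModuleCat.of G (BalancedTensor L P W)) n) :
    Module.Projective G (BalancedTensor L P V) := by
  obtain ⟨T, d, hT, hd, -, ⟨e⟩⟩ := hV
  -- The cokernels of `P ⊗ T` are `P ⊗ W` with `W` a cokernel of `T`, so `n` bounds them all at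
  -- once.
  have := projective_coker_of_exact (fun i => BalancedTensor L P (T i))
    (fun i => BalancedTensor.lTensor G P (d i)) (fun i => BalancedTensor.projective_left)
    (fun i => BalancedTensor.exact_map_id (hd i)) n (fun i =>
      have := hn (T (i + 1) ⧸ LinearMap.range (d i))
      hasProjectiveDimensionLT_of_iso (BalancedTensor.cokerEquiv P (d i)).symm.toModuleIso _) 0
  exact Module.Projective.of_equiv
    ((BalancedTensor.cokerEquiv P (d 0)).trans (BalancedTensor.congrRight P e).symm)

theorem mainTheorem6 {k : Type w} [Field k]
    {L : Type u} [Ring L] [Algebra k L] [Module.Finite k L]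
    {G : Type u} [Ring G] [Algebra k G] [Module.Finite k G]
    (hL : IsGorensteinAlgebra L) (hG : IsGorensteinAlgebra G)
    {X : Type u} [AddCommGroup X] [Module k X] [Module G X] [Module Lᵐᵒᵖ X]
    [IsScalarTower k G X] [IsScalarTower k Lᵐᵒᵖ X] [SMulCommClass G Lᵐᵒᵖ X]
    {Y : Type u} [AddCommGroup Y] [Module k Y] [Module L Y] [Module Gᵐᵒᵖ Y]
    [IsScalarTower k L Y] [IsScalarTower k Gᵐᵒᵖ Y] [SMulCommClass L Gᵐᵒᵖ Y]
    (hXY : IsSingularEquivalenceOfMoritaType k L G X Y)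
    {V : Type u} [AddCommGroup V] [Module L V] [Module.Finite L V]
    (hV : IsGorensteinProjective L V) :
    (Module.Finite G (BalancedTensor L X V) ∧
      IsGorensteinProjective G (BalancedTensor L X V)) ∧
    ∀ (P : Type u) [AddCommGroup P] [Module k P] [Module L P] [Module Lᵐᵒᵖ P]
      [IsScalarTower k L P] [IsScalarTower k Lᵐᵒᵖ P] [SMulCommClass L Lᵐᵒᵖ P],
      IsFiniteProjDimComplement k L G Y X P →
        Module.Finite L (BalancedTensor L P V) ∧ Module.Projective L (BalancedTensor L P V) := by
  have := hXY.finite_left_X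
  have := hXY.projective_left_X
  have := hXY.projective_right_X
  have := hXY.finite_left_Y
  have := hXY.projective_left_Y
  have := hXY.projective_right_Y
  refine ⟨⟨BalancedTensor.finite_left, hV.balancedTensor hG.1⟩, fun P _ _ _ _ _ _ _ hP => ?_⟩
  obtain ⟨e, he⟩ := hP.iso
  have : Module.Finite L (BalancedTensor G Y X) := BalancedTensor.finite_left
  have : Module.Projective L (BalancedTensor G Y X) := BalancedTensor.projective_left
  have : Module.Projective Lᵐᵒᵖ (BalancedTensor G Y X) := BalancedTensor.projective_right
  -- `P` is a bimodule summand of `Y ⊗ X`, so it inherits finiteness on the left and projectivity on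
  -- both sides.
  have : Module.Finite L P := Module.Finite.of_surjective
    (LinearMap.snd L L P ∘ₗ e.toLinearMap) (Prod.snd_surjective.comp e.surjective)
  have : Module.Projective L P := Module.Projective.of_split
    (e.symm.toLinearMap ∘ₗ LinearMap.inr L L P) (LinearMap.snd L L P ∘ₗ e.toLinearMap)
    (LinearMap.ext fun p => by simp)
  let e' : BalancedTensor G Y X ≃ₗ[Lᵐᵒᵖ] L × P := { e with map_smul' := he }
  have : Module.Projective Lᵐᵒᵖ P := Module.Projective.of_split
    (e'.symm.toLinearMap ∘ₗ LinearMap.inr Lᵐᵒᵖ L P) (LinearMap.snd Lᵐᵒᵖ L P ∘ₗ e'.toLinearMap)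
    (LinearMap.ext fun p => by simp)
  refine ⟨BalancedTensor.finite_left, ?_⟩
  obtain ⟨n, hn⟩ := hP.finiteProjDim
  let : Module (L ⊗[k] Lᵐᵒᵖ) P := TensorProduct.Algebra.module
  exact hV.projective_balancedTensor n fun W _ _ =>
    BalancedTensor.hasProjectiveDimensionLE_of_enveloping (k := k) W n P
      (fun a p => by rw [TensorProduct.Algebra.smul_def, one_smul])
      (fun b p => by rw [TensorProduct.Algebra.smul_def, one_smul]) hn
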